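/- A non-ambiguous tree is a filling of an $m\times n$ rectangular grid, each cell being dotted or not, such that: the top-left cell (the root) is dotted; every dotted cell other than the root has either a dotted cell above it in the same column or a dotted cell to its left in the same row, but not both; every row and every column contains at least one dotted cell. It is complete (a CNAT) if every dot has either both a dot below it in the same column and a dot to its right in the same row, or neither of these; in the latter case the dot is called a leaf. The size of a CNAT is its number of leaves. In a CNAT $T$ of size $n$ every row and every column contains exactly one leaf, so the grid is $n\times n$ and the leaves form the graph of a permutation $\pi(T)$ of $\{1,\dots,n\}$, the leaf permutation. Let $M(T)$ be the $n\times n$ matrix with entry $1$ at the dotted cells and $0$ elsewhere. Let $T_n$ be the number of CNATs of size $n$ and, for $\epsilon\in\{+1,-1\}$, let $T(n;\epsilon)$ be the number of CNATs $T$ of size $n$ with $\det M(T)=\epsilon$. Theorem. If $n>1$ is odd, then $$T(n;+1)=T(n;-1)=\frac{T_n}{2}.$$ If $n=2p$ is even, then $$T(2p;+1)=\frac{T_{2p}+(-1)^pT_p}{2}\quad\text{and}\quad T(2p;-1)=\frac{T_{2p}-(-1)^pT_p}{2}.$$ The same identities hold when $T(n;\epsilon)$ is replaced by the number of CNATs $T$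 of size $n$ whose leaf permutation $\pi(T)$ has sign $\epsilon$. -/

import Mathlib

/-- A non-ambiguous tree: a filling of a `rows × cols` grid.  Cells are pairs `(row, column)`,
rows being numbered from top to bottom and columns from left to right, starting from `0`;
`dots` is the set of dotted cells. -/
@[ext]
structure NonAmbiguousTree where
  /-- number of rows of the grid -/
  rows : ℕ
  /-- number of columns of the grid -/
  cols : ℕ
  /-- the dotted cells -/
  dots : Finset (ℕ × ℕ)
  /-- all the dotted cells lie in the grid -/
  mem_grid : ∀ d ∈ dots, d.1 < rows ∧ d.2 < cols
  /-- existence of a root: the top-left cell is dotted -/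
  root_mem : (0, 0) ∈ dots
  /-- non ambiguity: a dotted cell other than the root has either a dotted cell above it in the
  same column or a dotted cell to its left in the same row, but not both -/
  nonambiguous : ∀ d ∈ dots, d ≠ (0, 0) →
    Xor (∃ i, i < d.1 ∧ (i, d.2) ∈ dots) (∃ j, j < d.2 ∧ (d.1, j) ∈ dots)
  /-- minimality: every row contains a dotted cell -/
  row_nonempty : ∀ i, i < rows → ∃ j, (i, j) ∈ dots
  /-- minimality: every column contains a dotted cell -/
  col_nonempty : ∀ j, j < cols → ∃ i, (i, j) ∈ dots

namespace NonAmbiguousTree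

/-- There is a dot below the cell `d`, in the same column. -/
def HasBelow (T : NonAmbiguousTree) (d : ℕ × ℕ) : Prop := ∃ i, d.1 < i ∧ (i, d.2) ∈ T.dots

/-- There is a dot to the right of the cell `d`, in the same row. -/
def HasRight (T : NonAmbiguousTree) (d : ℕ × ℕ) : Prop := ∃ j, d.2 < j ∧ (d.1, j) ∈ T.dots

/-- A leaf: a dot with neither a dot below it nor a dot to its right. -/
def IsLeaf (T : NonAmbiguousTree) (d : ℕ × ℕ) : Prop :=
  d ∈ T.dots ∧ ¬ T.HasBelow d ∧ ¬ T.HasRight d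

end NonAmbiguousTree

/-- A complete non-ambiguous tree: every dot has either both a dot below it in the same column
and a dot to its right in the same row, or neither of these. -/
@[ext]
structure CNAT extends NonAmbiguousTree where
  complete : ∀ d ∈ dots,
    (toNonAmbiguousTree.HasBelow d ∧ toNonAmbiguousTree.HasRight d) ∨
    (¬ toNonAmbiguousTree.HasBelow d ∧ ¬ toNonAmbiguousTree.HasRight d)

namespace CNAT

open Classical in
/-- The set of leaf dots. -/
noncomputable def leaves (T : CNAT) : Finset (ℕ × ℕ) :=
  T.dots.filter (fun d => T.toNonAmbiguousTree.IsLeaf d)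

/-- The size of a complete non-ambiguous tree: its number of leaf dots. -/
noncomputable def size (T : CNAT) : ℕ := T.leaves.card

theorem mem_leaves {T : CNAT} {d : ℕ × ℕ} : d ∈ T.leaves ↔ T.toNonAmbiguousTree.IsLeaf d := by
  classical
  unfold leaves
  rw [Finset.mem_filter]
  exact ⟨fun h => h.2, fun h => ⟨h.1, h⟩⟩

/-- Every row has exactly one leaf. -/
theorem existsUnique_leaf_row (T : CNAT) {i : ℕ} (hi : i < T.rows) :
    ∃! j, (i, j) ∈ T.leaves := by
  classical
  obtain ⟨j₀, hj₀⟩ := T.row_nonempty i hi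
  let S := (T.dots.filter (fun d => d.1 = i)).image Prod.snd
  have hS : ∀ j, j ∈ S ↔ (i, j) ∈ T.dots := by
    intro j
    simp only [S, Finset.mem_image, Finset.mem_filter]
    constructor
    · rintro ⟨⟨a, b⟩, ⟨h1, h2⟩, h3⟩
      simp only at h2 h3
      rw [← h2, ← h3]
      exact h1
    · intro h
      exact ⟨(i, j), ⟨h, rfl⟩, rfl⟩
  have hne : S.Nonempty := ⟨j₀, (hS j₀).2 hj₀⟩
  have hmax := (hS _).1 (S.max'_mem hne)
  have hnr : ¬ T.toNonAmbiguousTree.HasRight (i, S.max' hne) := by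
    rintro ⟨j, hj, hd⟩
    exact absurd (S.le_max' j ((hS j).2 hd)) (not_le.2 hj)
  refine ⟨S.max' hne, mem_leaves.2 ⟨hmax, ?_, hnr⟩, ?_⟩
  · rcases T.complete _ hmax with h | h
    · exact absurd h.2 hnr
    · exact h.1
  · intro j hj
    obtain ⟨h1, -, h3⟩ := mem_leaves.1 hj
    refine le_antisymm (S.le_max' j ((hS j).2 h1)) (not_lt.1 fun hlt => h3 ⟨_, hlt, hmax⟩)

/-- Every column has exactly one leaf. -/
theorem existsUnique_leaf_col (T : CNAT) {j : ℕ} (hj : j < T.cols) :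
    ∃! i, (i, j) ∈ T.leaves := by
  classical
  obtain ⟨i₀, hi₀⟩ := T.col_nonempty j hj
  let S := (T.dots.filter (fun d => d.2 = j)).image Prod.fst
  have hS : ∀ i, i ∈ S ↔ (i, j) ∈ T.dots := by
    intro i
    simp only [S, Finset.mem_image, Finset.mem_filter]
    constructor
    · rintro ⟨⟨a, b⟩, ⟨h1, h2⟩, h3⟩
      simp only at h2 h3
      rw [← h2, ← h3]
      exact h1
    · intro h
      exact ⟨(i, j), ⟨h, rfl⟩, rfl⟩
  have hne : S.Nonempty := ⟨i₀, (hS i₀).2 hi₀⟩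
  have hmax := (hS _).1 (S.max'_mem hne)
  have hnb : ¬ T.toNonAmbiguousTree.HasBelow (S.max' hne, j) := by
    rintro ⟨i, hi, hd⟩
    exact absurd (S.le_max' i ((hS i).2 hd)) (not_le.2 hi)
  refine ⟨S.max' hne, mem_leaves.2 ⟨hmax, hnb, ?_⟩, ?_⟩
  · rcases T.complete _ hmax with h | h
    · exact absurd h.1 hnb
    · exact h.2
  · intro i hi
    obtain ⟨h1, h2, -⟩ := mem_leaves.1 hi
    refine le_antisymm (S.le_max' i ((hS i).2 h1)) (not_lt.1 fun hlt => h2 ⟨_, hlt, hmax⟩)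

theorem mem_grid_of_mem_leaves {T : CNAT} {d : ℕ × ℕ} (hd : d ∈ T.leaves) :
    d.1 < T.rows ∧ d.2 < T.cols :=
  T.mem_grid d (mem_leaves.1 hd).1

/-- The number of rows is the size. -/
theorem rows_eq_size (T : CNAT) : T.rows = T.size := by
  rw [size, ← Finset.card_range T.rows]
  symm
  refine Finset.card_bij (fun d _ => d.1) ?_ ?_ ?_
  · intro d hd
    exact Finset.mem_range.2 (mem_grid_of_mem_leaves hd).1
  · rintro ⟨a, b⟩ h1 ⟨a', b'⟩ h2 h
    simp only at h
    subst h
    rw [(T.existsUnique_leaf_row (mem_grid_of_mem_leaves h1).1).unique h1 h2]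
  · intro i hi
    obtain ⟨j, hj, -⟩ := T.existsUnique_leaf_row (Finset.mem_range.1 hi)
    exact ⟨(i, j), hj, rfl⟩

/-- The number of columns is the size. -/
theorem cols_eq_size (T : CNAT) : T.cols = T.size := by
  rw [size, ← Finset.card_range T.cols]
  symm
  refine Finset.card_bij (fun d _ => d.2) ?_ ?_ ?_
  · intro d hd
    exact Finset.mem_range.2 (mem_grid_of_mem_leaves hd).2
  · rintro ⟨a, b⟩ h1 ⟨a', b'⟩ h2 h
    simp only at h
    subst h
    rw [(T.existsUnique_leaf_col (mem_grid_of_mem_leaves h1).2).unique h1 h2]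
  · intro j hj
    obtain ⟨i, hi, -⟩ := T.existsUnique_leaf_col (Finset.mem_range.1 hj)
    exact ⟨(i, j), hi, rfl⟩

/-- The matrix of a complete non-ambiguous tree: dotted cells are `1`, the others are `0`.
By `rows_eq_size` and `cols_eq_size` its index set is exactly the grid. -/
def matrix (T : CNAT) : Matrix (Fin T.size) (Fin T.size) ℤ :=
  Matrix.of fun i j => if ((i : ℕ), (j : ℕ)) ∈ T.dots then 1 else 0

theorem existsUnique_leaf_row_fin (T : CNAT) (i : Fin T.size) :
    ∃! j : Fin T.size, ((i : ℕ), (j : ℕ)) ∈ T.leaves := by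
  obtain ⟨j, hj, hu⟩ := T.existsUnique_leaf_row (i := i) (by rw [rows_eq_size]; exact i.2)
  refine ⟨⟨j, ?_⟩, hj, fun k hk => Fin.ext (hu k hk)⟩
  rw [← cols_eq_size]
  exact (mem_grid_of_mem_leaves hj).2

/-- The column of the unique leaf of row `i`. -/
noncomputable def leafCol (T : CNAT) (i : Fin T.size) : Fin T.size :=
  (T.existsUnique_leaf_row_fin i).choose

theorem leafCol_mem (T : CNAT) (i : Fin T.size) : ((i : ℕ), (T.leafCol i : ℕ)) ∈ T.leaves :=
  (T.existsUnique_leaf_row_fin i).choose_spec.1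

theorem leafCol_bijective (T : CNAT) : Function.Bijective T.leafCol := by
  refine Finite.injective_iff_bijective.1 fun i i' h => Fin.ext ?_
  have h1 := T.leafCol_mem i
  have h2 := T.leafCol_mem i'
  rw [← h] at h2
  exact (T.existsUnique_leaf_col (mem_grid_of_mem_leaves h1).2).unique h1 h2

/-- The permutation associated with a complete non-ambiguous tree: its graph is the set of leaf
dots (it sends a row to the column of the leaf of that row). -/
noncomputable def leafPerm (T : CNAT) : Equiv.Perm (Fin T.size) :=
  Equiv.ofBijective T.leafCol T.leafCol_bijective

/-- The set of complete non-ambiguous trees of size `n`. -/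
def ofSize (n : ℕ) : Set CNAT := {T | T.size = n}

/-- There are finitely many complete non-ambiguous trees of a given size, so that the
cardinalities below are genuine. -/
theorem finite_ofSize (n : ℕ) : (ofSize n).Finite := by
  refine Set.Finite.of_finite_image (f := fun T : CNAT => T.dots) ?_ ?_
  · refine Set.Finite.subset
      (Finset.finite_toSet (Finset.range n ×ˢ Finset.range n).powerset) ?_
    rintro _ ⟨T, hT, rfl⟩
    have hT' : T.size = n := hT
    simp only [Finset.coe_powerset, Set.mem_preimage, Set.mem_powerset_iff]
    intro d hd
    have := T.mem_grid d hd
    rw [rows_eq_size, cols_eq_size, hT'] at this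
    simpa using this
  · intro T hT T' hT' h
    have h1 : T.size = n := hT
    have h2 : T'.size = n := hT'
    refine CNAT.ext ?_ ?_ h
    · rw [rows_eq_size, rows_eq_size, h1, h2]
    · rw [cols_eq_size, cols_eq_size, h1, h2]

/-- The number of complete non-ambiguous trees of size `n`. -/
noncomputable def count (n : ℕ) : ℕ := (ofSize n).ncard

/-- The number of complete non-ambiguous trees of size `n` with determinant `ε`. -/
noncomputable def detCount (n : ℕ) (ε : ℤ) : ℕ :=
  {T ∈ ofSize n | T.matrix.det = ε}.ncard

/-- The number of complete non-ambiguous trees of size `n` whose leaf permutation has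
sign `ε`. -/
noncomputable def signCount (n : ℕ) (ε : ℤ) : ℕ :=
  {T ∈ ofSize n | ((Equiv.Perm.sign T.leafPerm : ℤˣ) : ℤ) = ε}.ncard

end CNAT

/-!
The determinant of `M(T)` is the sign of the leaf permutation: the leaf of a row is its rightmost
dot, so a permutation whose graph is made of dots is pointwise at most the leaf permutation, and
two permutations one of which bounds the other are equal (`CNAT.det_matrix`). Hence all the
determinants are `± 1`, the two families of counts agree, and it remains to compute the sum `S n`
of the determinants over all trees of size `n`.

Exchanging two consecutive rows other than the first one gives a tree again as soon as no column
has a dot in both rows, and changes the sign of the determinant. Group the rows in disjoint pairs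
of consecutive rows, and the columns likewise: the trees in which some pair is not linked by a
common dotted column, resp. row, cancel (`CNAT.detSum_true_eq`).

The remaining trees are understood by a parity argument. Seen as a bipartite graph on rows and
columns, the dots form a forest, so the indicator of a dot can be written `u (row) + v (column)`
modulo `2` (`NonAmbiguousTree.exists_potential`). The sum of all `u` and `v` can be computed along
the leaves, which meet every row and every column once, or pair by pair.
* For odd `n > 1` the pairs cover everything except row `0` and column `0`. Taking the indicator of
  the root gives `0 = 1`, so no tree remains and `S n = 0` (`CNAT.not_allLinked_of_odd`).
* For `n = 2 * p` the pairs `2 * a`, `2 * a + 1` cover everything, and a dot is a leaf if and only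
  if it belongs to exactly one of the links of rows and links of columns
  (`CNAT.Paired.mem_leaves_iff`). This forces each nonempty `2 × 2` block to contain either its
  upper left cell only, or three dots, two of which are leaves. The upper left cells form a tree of
  size `p`, arbitrary since it can be doubled back (`CNAT.double`), and the determinant of the
  doubled tree is `(-1) ^ p` (`CNAT.det_double`). Thus `S (2 * p) = (-1) ^ p * T_p`.
-/

/-! ### Links of consecutive rows and the forest structure -/

namespace NonAmbiguousTree

/-- Rows `r` and `r + 1` are linked: some column has a dot in both. -/
def RowsLinked (T : NonAmbiguousTree) (r : ℕ) : Prop :=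
  ∃ c, (r, c) ∈ T.dots ∧ (r + 1, c) ∈ T.dots

/-- Columns `c` and `c + 1` are linked: some row has a dot in both. -/
def ColsLinked (T : NonAmbiguousTree) (c : ℕ) : Prop :=
  ∃ r, (r, c) ∈ T.dots ∧ (r, c + 1) ∈ T.dots

/-- No dot has both a dot above it and a dot to its left. -/
theorem not_above_and_left (T : NonAmbiguousTree) {i j i' j' : ℕ} (h : (i, j) ∈ T.dots)
    (hi : i' < i) (habove : (i', j) ∈ T.dots) (hj : j' < j) (hleft : (i, j') ∈ T.dots) : False := by
  have hne : (i, j) ≠ (0, 0) := fun h0 => by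
    rw [Prod.mk.injEq] at h0
    omega
  rcases T.nonambiguous _ h hne with ⟨-, h2⟩ | ⟨-, h2⟩
  · exact h2 ⟨j', hj, hleft⟩
  · exact h2 ⟨i', hi, habove⟩

theorem rowsLinked_col_unique (T : NonAmbiguousTree) {r c c' : ℕ} (h : (r, c) ∈ T.dots)
    (h1 : (r + 1, c) ∈ T.dots) (h' : (r, c') ∈ T.dots) (h1' : (r + 1, c') ∈ T.dots) : c' = c := by
  rcases lt_trichotomy c c' with hlt | heq | hlt
  · exact (T.not_above_and_left h1' r.lt_succ_self h' hlt h1).elim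
  · exact heq.symm
  · exact (T.not_above_and_left h1 r.lt_succ_self h hlt h1').elim

/-- The leftmost dot of row `1` has a dot above it, necessarily in row `0`. -/
theorem rowsLinked_zero (T : NonAmbiguousTree) (h : 1 < T.rows) : T.RowsLinked 0 := by
  classical
  have hex := T.row_nonempty 1 h
  have hc := Nat.find_spec hex
  rcases T.nonambiguous _ hc (by simp) with ⟨⟨i, hi, hd⟩, -⟩ | ⟨⟨j, hj, hd⟩, -⟩
  · obtain rfl : i = 0 := by simpa using hi
    exact ⟨_, hd, hc⟩
  · exact (Nat.find_min hex hj hd).elim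

/-- As a bipartite graph whose vertices are the rows and the columns and whose edges are the
dots, a non-ambiguous tree is a forest: every function on its dots is the sum of a function of
the row and a function of the column. -/
theorem exists_potential {A : Type*} [AddCommGroup A] (T : NonAmbiguousTree) (w : ℕ × ℕ → A) :
    ∃ u v : ℕ → A, ∀ i j, (i, j) ∈ T.dots → u i + v j = w (i, j) := by
  classical
  -- The functions are adjusted one antidiagonal at a time: a dot with no dot to its left is the
  -- first constraint on the value of its row, one with no dot above it on that of its column.
  have key : ∀ N : ℕ, ∃ u v : ℕ → A,
      ∀ i j, (i, j) ∈ T.dots → i + j < N → u i + v j = w (i, j) := by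
    intro N
    induction N with
    | zero => exact ⟨0, 0, fun i j _ h => absurd h (Nat.not_lt_zero _)⟩
    | succ N ih =>
      obtain ⟨u, v, huv⟩ := ih
      rcases Nat.eq_zero_or_pos N with rfl | hN
      -- the root is the only dot without a parent
      · refine ⟨fun _ => w (0, 0), 0, fun i j _ h => ?_⟩
        obtain ⟨rfl, rfl⟩ : i = 0 ∧ j = 0 := by omega
        simp
      refine ⟨fun i => if i ≤ N ∧ (i, N - i) ∈ T.dots ∧ ∃ i' < i, (i', N - i) ∈ T.dots then
          w (i, N - i) - v (N - i) else u i,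
        fun j => if j ≤ N ∧ (N - j, j) ∈ T.dots ∧ ∃ j' < j, (N - j, j') ∈ T.dots then
          w (N - j, j) - u (N - j) else v j, fun i j hd hlt => ?_⟩
      rcases Nat.lt_succ_iff_lt_or_eq.1 hlt with hlt | rfl
      · beta_reduce
        rw [if_neg, if_neg]
        · exact huv i j hd hlt
        · rintro ⟨h1, h2, j', hj', h3⟩
          exact T.not_above_and_left h2 (i' := i) (by omega) hd hj' h3
        · rintro ⟨h1, h2, i', hi', h3⟩
          exact T.not_above_and_left h2 hi' h3 (j' := j) (by omega) hd
      · have hne : (i, j) ≠ (0, 0) := fun h0 => by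
          rw [Prod.mk.injEq] at h0
          omega
        simp only [Nat.add_sub_cancel_left, Nat.add_sub_cancel, Nat.le_add_right, Nat.le_add_left,
          hd, true_and]
        rcases T.nonambiguous _ hd hne with ⟨h1, h2⟩ | ⟨h1, h2⟩
        · rw [if_pos h1, if_neg h2, sub_add_cancel]
        · rw [if_pos h1, if_neg h2, add_sub_cancel]
  obtain ⟨u, v, huv⟩ := key (T.rows + T.cols)
  refine ⟨u, v, fun i j hd => huv i j hd ?_⟩
  have := T.mem_grid _ hd
  simp only at this
  omega

end NonAmbiguousTree

namespace CNAT

/-! ### The determinant is the sign of the leaf permutation -/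

/-- The `0`-`1` matrix of size `n` supported by a set of cells. -/
def dotMatrix (n : ℕ) (D : Finset (ℕ × ℕ)) : Matrix (Fin n) (Fin n) ℤ :=
  Matrix.of fun i j => if ((i : ℕ), (j : ℕ)) ∈ D then 1 else 0

theorem det_matrix_eq {T : CNAT} {n : ℕ} (h : T.size = n) :
    T.matrix.det = (dotMatrix n T.dots).det := by
  subst h
  rfl

/-- Leaves are the rightmost dots of their rows, so a permutation whose graph consists of dots is
bounded by the leaf permutation, hence equal to it: the determinant has a single term. -/
theorem det_dotMatrix_eq_sign (T : CNAT) {D : Finset (ℕ × ℕ)} (h1 : T.leaves ⊆ D)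
    (h2 : D ⊆ T.dots) : (dotMatrix T.size D).det = (Equiv.Perm.sign T.leafPerm : ℤˣ) := by
  rw [← Matrix.det_transpose, Matrix.det_apply', Finset.sum_eq_single T.leafPerm]
  · have hone : ∏ i, (dotMatrix T.size D).transpose (T.leafPerm i) i = 1 :=
      Finset.prod_eq_one fun i _ => if_pos (h1 (T.leafCol_mem i))
    rw [hone, mul_one, Int.cast_id]
  · intro σ _ hσ
    rw [mul_eq_zero]
    right
    by_contra hprod
    rw [← ne_eq, Finset.prod_ne_zero_iff] at hprod
    have hmem : ∀ i : Fin T.size, ((i : ℕ), (σ i : ℕ)) ∈ T.dots := fun i => by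
      by_contra hi
      exact hprod i (Finset.mem_univ i) (if_neg fun h => hi (h2 h))
    have hle : ∀ i ∈ Finset.univ, (σ i : ℕ) ≤ (T.leafPerm i : ℕ) := fun i _ =>
      not_lt.1 fun hlt => (mem_leaves.1 (T.leafCol_mem i)).2.2 ⟨_, hlt, hmem i⟩
    have hsum : ∑ i, (σ i : ℕ) = ∑ i, (T.leafPerm i : ℕ) := by
      rw [Equiv.sum_comp σ fun j : Fin T.size => (j : ℕ),
        Equiv.sum_comp T.leafPerm fun j : Fin T.size => (j : ℕ)]
    exact hσ (Equiv.ext fun i =>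
      Fin.ext ((Finset.sum_eq_sum_iff_of_le hle).1 hsum i (Finset.mem_univ i)))
  · exact fun h => absurd (Finset.mem_univ _) h

theorem leaves_subset_dots (T : CNAT) : T.leaves ⊆ T.dots := fun _ h => (mem_leaves.1 h).1

theorem det_matrix (T : CNAT) : T.matrix.det = (Equiv.Perm.sign T.leafPerm : ℤˣ) :=
  T.det_dotMatrix_eq_sign T.leaves_subset_dots subset_rfl

/-! ### Summation along the leaves -/

theorem sum_leaves_fst {A : Type*} [AddCommMonoid A] (T : CNAT) (f : ℕ → A) :
    ∑ d ∈ T.leaves, f d.1 = ∑ i ∈ Finset.range T.rows, f i := by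
  refine Finset.sum_bij (fun d _ => d.1) ?_ ?_ ?_ fun _ _ => rfl
  · exact fun d hd => Finset.mem_range.2 (mem_grid_of_mem_leaves hd).1
  · rintro ⟨a, b⟩ h1 ⟨a', b'⟩ h2 h
    simp only at h
    subst h
    rw [(T.existsUnique_leaf_row (mem_grid_of_mem_leaves h1).1).unique h1 h2]
  · intro i hi
    obtain ⟨j, hj, -⟩ := T.existsUnique_leaf_row (Finset.mem_range.1 hi)
    exact ⟨(i, j), hj, rfl⟩

theorem sum_leaves_snd {A : Type*} [AddCommMonoid A] (T : CNAT) (f : ℕ → A) :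
    ∑ d ∈ T.leaves, f d.2 = ∑ j ∈ Finset.range T.cols, f j := by
  refine Finset.sum_bij (fun d _ => d.2) ?_ ?_ ?_ fun _ _ => rfl
  · exact fun d hd => Finset.mem_range.2 (mem_grid_of_mem_leaves hd).2
  · rintro ⟨a, b⟩ h1 ⟨a', b'⟩ h2 h
    simp only at h
    subst h
    rw [(T.existsUnique_leaf_col (mem_grid_of_mem_leaves h1).2).unique h1 h2]
  · intro j hj
    obtain ⟨i, hi, -⟩ := T.existsUnique_leaf_col (Finset.mem_range.1 hj)
    exact ⟨(i, j), hi, rfl⟩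

/-! ### Transposition -/

/-- The reflection of a complete non-ambiguous tree in its main diagonal. -/
noncomputable def transpose (T : CNAT) : CNAT where
  rows := T.cols
  cols := T.rows
  dots := T.dots.preimage Prod.swap Prod.swap_injective.injOn
  mem_grid d hd := (T.mem_grid _ (Finset.mem_preimage.1 hd)).symm
  root_mem := Finset.mem_preimage.2 T.root_mem
  nonambiguous := by
    rintro ⟨i, j⟩ hd hne
    simp only [Finset.mem_preimage, Prod.swap_prod_mk] at hd ⊢
    exact (T.nonambiguous (j, i) hd fun h => hne (by simp_all)).symm
  row_nonempty i hi := by simpa using T.col_nonempty i hi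
  col_nonempty j hj := by simpa using T.row_nonempty j hj
  complete := by
    rintro ⟨i, j⟩ hd
    simp only [NonAmbiguousTree.HasBelow, NonAmbiguousTree.HasRight, Finset.mem_preimage,
      Prod.swap_prod_mk] at hd ⊢
    exact (T.complete (j, i) hd).imp And.symm And.symm

theorem rows_transpose (T : CNAT) : T.transpose.rows = T.cols := rfl

theorem mem_transpose {T : CNAT} {i j : ℕ} : (i, j) ∈ T.transpose.dots ↔ (j, i) ∈ T.dots := by
  simp [transpose]

theorem transpose_transpose (T : CNAT) : T.transpose.transpose = T :=
  CNAT.ext rfl rfl (by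
    ext ⟨i, j⟩
    rw [mem_transpose, mem_transpose])

theorem size_transpose (T : CNAT) : T.transpose.size = T.size := by
  rw [← rows_eq_size, ← cols_eq_size]
  rfl

theorem det_transpose (T : CNAT) : T.transpose.matrix.det = T.matrix.det := by
  rw [det_matrix_eq T.size_transpose, det_matrix_eq rfl, ← Matrix.det_transpose]
  congr 1
  ext i j
  simp only [dotMatrix, Matrix.transpose_apply, Matrix.of_apply, mem_transpose]

theorem rowsLinked_transpose {T : CNAT} {r : ℕ} :
    T.transpose.RowsLinked r ↔ T.ColsLinked r := by
  simp only [NonAmbiguousTree.RowsLinked, NonAmbiguousTree.ColsLinked, mem_transpose]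

theorem colsLinked_transpose {T : CNAT} {c : ℕ} :
    T.transpose.ColsLinked c ↔ T.RowsLinked c := by
  simp only [NonAmbiguousTree.RowsLinked, NonAmbiguousTree.ColsLinked, mem_transpose]

/-! ### Exchange of two consecutive rows -/

theorem swap_lt_swap_iff {T : CNAT} {r : ℕ} (hs : ¬ T.RowsLinked r) {i i' j : ℕ}
    (h : (i, j) ∈ T.dots) (h' : (i', j) ∈ T.dots) :
    Equiv.swap r (r + 1) i < Equiv.swap r (r + 1) i' ↔ i < i' := by
  have h1 : ¬ (i = r ∧ i' = r + 1) := by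
    rintro ⟨rfl, rfl⟩
    exact hs ⟨j, h, h'⟩
  have h2 : ¬ (i = r + 1 ∧ i' = r) := by
    rintro ⟨rfl, rfl⟩
    exact hs ⟨j, h', h⟩
  simp only [Equiv.swap_apply_def]
  split_ifs <;> omega

theorem exists_lt_swap_iff {T : CNAT} {r : ℕ} (hs : ¬ T.RowsLinked r) {i j : ℕ}
    (h : (Equiv.swap r (r + 1) i, j) ∈ T.dots) :
    (∃ i', i' < i ∧ (Equiv.swap r (r + 1) i', j) ∈ T.dots) ↔
      ∃ i', i' < Equiv.swap r (r + 1) i ∧ (i', j) ∈ T.dots := by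
  constructor
  · rintro ⟨i', hlt, hd⟩
    refine ⟨_, ?_, hd⟩
    simpa using (swap_lt_swap_iff hs hd h).not.not.1 (by simpa using hlt)
  · rintro ⟨i', hlt, hd⟩
    refine ⟨Equiv.swap r (r + 1) i', ?_, by simpa using hd⟩
    simpa using (swap_lt_swap_iff hs hd h).2 hlt

theorem exists_gt_swap_iff {T : CNAT} {r : ℕ} (hs : ¬ T.RowsLinked r) {i j : ℕ}
    (h : (Equiv.swap r (r + 1) i, j) ∈ T.dots) :
    (∃ i', i < i' ∧ (Equiv.swap r (r + 1) i', j) ∈ T.dots) ↔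
      ∃ i', Equiv.swap r (r + 1) i < i' ∧ (i', j) ∈ T.dots := by
  constructor
  · rintro ⟨i', hlt, hd⟩
    refine ⟨_, ?_, hd⟩
    rw [← swap_lt_swap_iff hs h hd]
    simpa using hlt
  · rintro ⟨i', hlt, hd⟩
    refine ⟨Equiv.swap r (r + 1) i', ?_, by simpa using hd⟩
    simpa using (swap_lt_swap_iff hs h hd).2 hlt

theorem swap_lt_iff {r n : ℕ} (hr : r + 1 < n) (i : ℕ) : Equiv.swap r (r + 1) i < n ↔ i < n := by
  simp only [Equiv.swap_apply_def]
  split_ifs <;> omega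

/-- Exchanging two consecutive rows which are not linked, none of them being the first row.  The
order of the dots within each column is unchanged, so the result is a complete non-ambiguous
tree. -/
noncomputable def swapRows (T : CNAT) (r : ℕ) (h0 : 0 < r) (hr : r + 1 < T.rows)
    (hs : ¬ T.RowsLinked r) : CNAT where
  rows := T.rows
  cols := T.cols
  dots := T.dots.preimage (Prod.map (Equiv.swap r (r + 1)) id)
    (((Equiv.swap r (r + 1)).injective.prodMap Function.injective_id).injOn)
  mem_grid d hd := by
    have := T.mem_grid _ (Finset.mem_preimage.1 hd)
    exact ⟨(swap_lt_iff hr _).1 this.1, this.2⟩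
  root_mem := by
    have : Equiv.swap r (r + 1) 0 = 0 := Equiv.swap_apply_of_ne_of_ne h0.ne (Nat.succ_ne_zero r).symm
    simpa [this] using T.root_mem
  nonambiguous := by
    rintro ⟨i, j⟩ hd hne
    have h00 : Equiv.swap r (r + 1) 0 = 0 :=
      Equiv.swap_apply_of_ne_of_ne h0.ne (Nat.succ_ne_zero r).symm
    simp only [Finset.mem_preimage, Prod.map_apply, id_eq] at hd ⊢
    rw [exists_lt_swap_iff hs hd]
    refine T.nonambiguous _ hd fun h => hne ?_
    rw [Prod.mk.injEq] at h ⊢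
    exact ⟨(Equiv.swap r (r + 1)).injective (h.1.trans h00.symm), h.2⟩
  row_nonempty i hi := by
    simpa using T.row_nonempty _ ((swap_lt_iff hr i).2 hi)
  col_nonempty j hj := by
    obtain ⟨i, hi⟩ := T.col_nonempty j hj
    exact ⟨Equiv.swap r (r + 1) i, by simpa using hi⟩
  complete := by
    rintro ⟨i, j⟩ hd
    simp only [NonAmbiguousTree.HasBelow, NonAmbiguousTree.HasRight, Finset.mem_preimage,
      Prod.map_apply, id_eq] at hd ⊢
    rw [exists_gt_swap_iff hs hd]
    exact T.complete _ hd

section swapRows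

variable {T : CNAT} {r : ℕ} {h0 : 0 < r} {hr : r + 1 < T.rows} {hs : ¬ T.RowsLinked r}

theorem mem_swapRows {i j : ℕ} :
    (i, j) ∈ (T.swapRows r h0 hr hs).dots ↔ (Equiv.swap r (r + 1) i, j) ∈ T.dots := by
  simp [swapRows]

theorem size_swapRows : (T.swapRows r h0 hr hs).size = T.size := by
  rw [← rows_eq_size, ← rows_eq_size]
  rfl

theorem rowsLinked_swapRows_self : (T.swapRows r h0 hr hs).RowsLinked r ↔ T.RowsLinked r := by
  simp only [NonAmbiguousTree.RowsLinked, mem_swapRows, Equiv.swap_apply_left,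
    Equiv.swap_apply_right, and_comm]

theorem rowsLinked_swapRows_of_lt {k : ℕ} (hk : k + 1 < r) :
    (T.swapRows r h0 hr hs).RowsLinked k ↔ T.RowsLinked k := by
  simp only [NonAmbiguousTree.RowsLinked, mem_swapRows]
  rw [Equiv.swap_apply_of_ne_of_ne (by omega) (by omega),
    Equiv.swap_apply_of_ne_of_ne (by omega) (by omega)]

theorem colsLinked_swapRows {c : ℕ} :
    (T.swapRows r h0 hr hs).ColsLinked c ↔ T.ColsLinked c := by
  simp only [NonAmbiguousTree.ColsLinked, mem_swapRows]
  exact (Equiv.swap r (r + 1)).exists_congr_left.trans (by simp)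

theorem det_swapRows : (T.swapRows r h0 hr hs).matrix.det = -T.matrix.det := by
  have hr' := T.rows_eq_size ▸ hr
  rw [det_matrix_eq size_swapRows, det_matrix_eq rfl]
  have : dotMatrix T.size (T.swapRows r h0 hr hs).dots = (dotMatrix T.size T.dots).submatrix
      (Equiv.swap ⟨r, by omega⟩ ⟨r + 1, hr'⟩) id := by
    ext i j
    simp only [dotMatrix, Matrix.submatrix_apply, Matrix.of_apply, mem_swapRows, id_eq]
    congr 3
    simp only [Equiv.swap_apply_def, Fin.ext_iff]
    split_ifs <;> rfl
  rw [this, Matrix.det_permute, Equiv.Perm.sign_swap (by simp)]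
  simp

end swapRows

/-! ### Cancellation in the sum of the determinants -/

noncomputable def finsetOfSize (n : ℕ) : Finset CNAT := (finite_ofSize n).toFinset

theorem mem_finsetOfSize {n : ℕ} {T : CNAT} : T ∈ finsetOfSize n ↔ T.size = n := by
  simp [finsetOfSize, ofSize]

open Classical in
/-- The sum of the determinants of the trees of size `n` which satisfy `P`. -/
noncomputable def detSum (n : ℕ) (P : CNAT → Prop) : ℤ :=
  ∑ T ∈ finsetOfSize n with P T, T.matrix.det

theorem detSum_congr {n : ℕ} {P Q : CNAT → Prop} (h : ∀ T : CNAT, T.rows = n → (P T ↔ Q T)) :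
    detSum n P = detSum n Q := by
  classical
  refine Finset.sum_congr (Finset.filter_congr fun T hT => h T ?_) fun _ _ => rfl
  rwa [mem_finsetOfSize, ← rows_eq_size] at hT

theorem detSum_eq_zero {n : ℕ} {P : CNAT → Prop} (h : ∀ T : CNAT, T.rows = n → ¬ P T) :
    detSum n P = 0 := by
  classical
  refine Finset.sum_eq_zero fun T hT => ?_
  rw [Finset.mem_filter, mem_finsetOfSize, ← rows_eq_size] at hT
  exact (h T hT.1 hT.2).elim

theorem detSum_transpose (n : ℕ) (P : CNAT → Prop) :
    detSum n (fun T => P T.transpose) = detSum n P := by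
  classical
  refine Finset.sum_bij' (fun T _ => T.transpose) (fun T _ => T.transpose) ?_ ?_
    (fun T _ => T.transpose_transpose) (fun T _ => T.transpose_transpose)
    fun T _ => T.det_transpose.symm
  · intro T hT
    simpa [mem_finsetOfSize, size_transpose, transpose_transpose] using hT
  · intro T hT
    simpa [mem_finsetOfSize, size_transpose, transpose_transpose] using hT

/-- The exchange of rows `r` and `r + 1` cancels the trees in which these rows are not linked. -/
theorem detSum_and_rowsLinked {n r : ℕ} (h0 : 0 < r) (hr : r + 1 < n) (P : CNAT → Prop)
    (hP : ∀ (T : CNAT) hr hs, P T → P (T.swapRows r h0 hr hs)) :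
    detSum n (fun T => P T ∧ T.RowsLinked r) = detSum n P := by
  classical
  rw [detSum, detSum, ← Finset.sum_filter_add_sum_filter_not (Finset.filter P (finsetOfSize n))
    (fun T : CNAT => T.RowsLinked r)]
  have hmem : ∀ {T : CNAT}, T ∈ ((finsetOfSize n).filter P).filter (fun T => ¬ T.RowsLinked r) ↔
      (T.size = n ∧ P T) ∧ ¬ T.RowsLinked r := by
    intro T
    rw [Finset.mem_filter, Finset.mem_filter, mem_finsetOfSize]
  have hzero : ∑ T ∈ ((finsetOfSize n).filter P).filter (fun T => ¬ T.RowsLinked r),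
      T.matrix.det = 0 := by
    refine Finset.sum_involution (fun T hT => T.swapRows r h0
        (by rw [rows_eq_size, (hmem.1 hT).1.1]; exact hr) (hmem.1 hT).2) ?_ ?_ ?_ ?_
    · intro T hT
      rw [det_swapRows, add_neg_cancel]
    · intro T hT hne h
      have := congrArg (fun T : CNAT => T.matrix.det) h
      simp only [det_swapRows] at this
      omega
    · intro T hT
      rw [hmem] at hT ⊢
      rw [size_swapRows, rowsLinked_swapRows_self]
      exact ⟨⟨hT.1.1, hP _ _ _ hT.1.2⟩, hT.2⟩
    · intro T hT
      refine CNAT.ext rfl rfl ?_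
      ext ⟨i, j⟩
      rw [mem_swapRows, mem_swapRows, Equiv.swap_apply_self]
  rw [hzero, add_zero]
  refine Finset.sum_congr ?_ fun _ _ => rfl
  ext T
  simp only [Finset.mem_filter, and_assoc]

/-- All pairs of consecutive rows `r`, `r + 1` with `r` of parity `s` are linked, except possibly
the first two rows (which are linked anyway). -/
def AllRowsLinked (s : ℕ) (T : CNAT) : Prop :=
  ∀ r, r % 2 = s → 0 < r → r + 1 < T.rows → T.RowsLinked r

theorem detSum_and_allRowsLinked {n : ℕ} (s : ℕ) (P : CNAT → Prop)
    (hP : ∀ (T : CNAT) r h0 hr hs, P T → P (T.swapRows r h0 hr hs)) :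
    detSum n (fun T => P T ∧ AllRowsLinked s T) = detSum n P := by
  have key : ∀ k : ℕ, detSum n (fun T =>
      P T ∧ ∀ r, r < k → r % 2 = s → 0 < r → r + 1 < T.rows → T.RowsLinked r) = detSum n P := by
    intro k
    induction k with
    | zero => simp
    | succ k ih =>
      rw [← ih]
      by_cases hk : k % 2 = s ∧ 0 < k ∧ k + 1 < n
      · rw [← detSum_and_rowsLinked hk.2.1 hk.2.2 fun T =>
          P T ∧ ∀ r, r < k → r % 2 = s → 0 < r → r + 1 < T.rows → T.RowsLinked r]
        · refine detSum_congr fun T hT => ?_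
          rw [and_assoc]
          refine and_congr_right fun _ => ⟨fun h => ⟨fun r hr => h r (by omega),
            h k (by omega) hk.1 hk.2.1 (hT ▸ hk.2.2)⟩, fun h r hr => ?_⟩
          rcases Nat.lt_succ_iff_lt_or_eq.1 hr with hr | rfl
          · exact h.1 r hr
          · exact fun _ _ _ => h.2
        · intro T hr hs h
          refine ⟨hP _ _ _ _ _ h.1, fun r hrk h1 h2 h3 => ?_⟩
          rw [rowsLinked_swapRows_of_lt (by omega)]
          exact h.2 r hrk h1 h2 h3
      · refine detSum_congr fun T hT => ?_
        refine and_congr_right fun _ => ⟨fun h r hr => h r (by omega), fun h r hr h1 h2 h3 => ?_⟩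
        refine h r ?_ h1 h2 h3
        rcases Nat.lt_succ_iff_lt_or_eq.1 hr with hr | rfl
        · exact hr
        · exact (hk ⟨h1, h2, hT ▸ h3⟩).elim
  rw [← key n]
  refine detSum_congr fun T hT => ?_
  exact and_congr_right fun _ => ⟨fun h r _ => h r, fun h r h1 h2 h3 => h r (by omega) h1 h2 h3⟩

/-- Only the trees in which the chosen pairs of rows and of columns are all linked contribute to
the sum of the determinants. -/
theorem detSum_true_eq (n s : ℕ) :
    detSum n (fun _ => True) =
      detSum n fun T => AllRowsLinked s T.transpose ∧ AllRowsLinked s T := by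
  rw [detSum_and_allRowsLinked s fun T => AllRowsLinked s T.transpose,
    detSum_transpose, ← detSum_and_allRowsLinked s fun _ => True]
  · simp only [true_and]
  · simp
  · intro T r h0 hr hs h k h1 h2 h3
    rw [rowsLinked_transpose, colsLinked_swapRows, ← rowsLinked_transpose]
    exact h k h1 h2 h3

/-! ### Trees of odd size -/

theorem rows_eq_cols (T : CNAT) : T.rows = T.cols :=
  T.rows_eq_size.trans T.cols_eq_size.symm

theorem sum_leaves_potential {T : CNAT} {u v : ℕ → ZMod 2} {w : ℕ × ℕ → ZMod 2}
    (huv : ∀ i j, (i, j) ∈ T.dots → u i + v j = w (i, j)) :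
    ∑ d ∈ T.leaves, w d =
      ∑ i ∈ Finset.range T.rows, u i + ∑ j ∈ Finset.range T.cols, v j := by
  rw [← T.sum_leaves_fst, ← T.sum_leaves_snd, ← Finset.sum_add_distrib]
  exact Finset.sum_congr rfl fun d hd => (huv d.1 d.2 (T.leaves_subset_dots hd)).symm

theorem sum_range_two_mul {A : Type*} [AddCommMonoid A] (f : ℕ → A) (p : ℕ) :
    ∑ i ∈ Finset.range (2 * p), f i = ∑ a ∈ Finset.range p, (f (2 * a) + f (2 * a + 1)) := by
  induction p with
  | zero => simp
  | succ p ih =>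
    rw [Finset.sum_range_succ, ← ih, mul_add, mul_one, Finset.sum_range_succ,
      Finset.sum_range_succ, add_assoc]

/-- If `u i + v j` vanishes at all dots but the root, then `u` takes the same value on two linked
rows below the first one, so the rows other than the first one cancel in pairs. -/
theorem sum_range_rows_of_odd {T : CNAT} {u v : ℕ → ZMod 2} (hodd : Odd T.rows)
    (hT : AllRowsLinked 1 T)
    (huv : ∀ i j, (i, j) ∈ T.dots → u i + v j = if (i, j) = (0, 0) then 1 else 0) :
    ∑ i ∈ Finset.range T.rows, u i = u 0 := by
  obtain ⟨p, hp⟩ := hodd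
  rw [hp, Finset.sum_range_succ', sum_range_two_mul fun i => u (i + 1), Finset.sum_eq_zero,
    zero_add]
  intro a ha
  rw [Finset.mem_range] at ha
  obtain ⟨c, h1, h2⟩ := hT (2 * a + 1) (by omega) (by omega) (by omega)
  have e1 := huv _ _ h1
  have e2 := huv _ _ h2
  rw [if_neg (by simp)] at e1 e2
  rw [eq_neg_of_add_eq_zero_left e1, eq_neg_of_add_eq_zero_left e2, ← neg_add,
    CharTwo.add_self_eq_zero, neg_zero]

/-- In odd size, some pair must fail to be linked.  Otherwise let `u i + v j` be the indicator of
the root, which is not a leaf: the sum of `u` and `v` is zero when evaluated along the leaves, and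
`u 0 + v 0 = 1` when evaluated along the pairs. -/
theorem not_allLinked_of_odd {T : CNAT} (h1 : 1 < T.rows) (hodd : Odd T.rows)
    (hC : AllRowsLinked 1 T.transpose) (hR : AllRowsLinked 1 T) : False := by
  obtain ⟨u, v, huv⟩ := T.exists_potential fun d => (if d = (0, 0) then 1 else 0 : ZMod 2)
  have hsum := sum_leaves_potential (w := fun d => if d = (0, 0) then 1 else 0) huv
  have hcols : ∑ j ∈ Finset.range T.cols, v j = v 0 := by
    refine sum_range_rows_of_odd (T := T.transpose) (u := v) (v := u)
      (by rwa [rows_transpose, ← rows_eq_cols]) hC fun i j hd => ?_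
    rw [add_comm, huv j i (mem_transpose.1 hd)]
    simp [and_comm]
  rw [sum_range_rows_of_odd hodd hR huv, hcols, huv 0 0 T.root_mem, if_pos rfl,
    Finset.sum_eq_zero] at hsum
  · exact zero_ne_one hsum
  · intro d hd
    refine if_neg ?_
    rintro rfl
    obtain ⟨c, hc0, hc1⟩ := T.rowsLinked_zero h1
    obtain ⟨-, hb, hr⟩ := mem_leaves.1 hd
    rcases Nat.eq_zero_or_pos c with rfl | hc
    · exact hb ⟨1, Nat.one_pos, hc1⟩
    · exact hr ⟨c, hc, hc0⟩

/-! ### Trees of even size all of whose pairs are linked -/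

/-- The involution of `ℕ` which exchanges `2 * a` and `2 * a + 1`. -/
def mate (i : ℕ) : ℕ := if i % 2 = 0 then i + 1 else i - 1

theorem mate_two_mul (a : ℕ) : mate (2 * a) = 2 * a + 1 := if_pos (by omega)

theorem mate_two_mul_add_one (a : ℕ) : mate (2 * a + 1) = 2 * a := if_neg (by omega)

/-- The size is even, and all the pairs of rows and of columns `2 * a`, `2 * a + 1` are linked. -/
structure Paired (T : CNAT) : Prop where
  even_rows : Even T.rows
  rows : ∀ a, 2 * a < T.rows → T.RowsLinked (2 * a)
  cols : ∀ b, 2 * b < T.cols → T.ColsLinked (2 * b)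

theorem Paired.transpose {T : CNAT} (hT : T.Paired) : T.transpose.Paired where
  even_rows := by
    rw [rows_transpose, ← rows_eq_cols]
    exact hT.even_rows
  rows a ha := rowsLinked_transpose.2 (hT.cols a ha)
  cols a ha := colsLinked_transpose.2 (hT.rows a ha)

theorem paired_iff {T : CNAT} (hT : Even T.rows) :
    T.Paired ↔ AllRowsLinked 0 T.transpose ∧ AllRowsLinked 0 T := by
  have hrc := T.rows_eq_cols
  obtain ⟨p, hp⟩ := hT
  constructor
  · intro h
    refine ⟨fun r hr _ hlt => ?_, fun r hr _ hlt => ?_⟩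
    · obtain ⟨a, rfl⟩ : ∃ a, r = 2 * a := ⟨r / 2, by omega⟩
      exact h.transpose.rows a (by omega)
    · obtain ⟨a, rfl⟩ : ∃ a, r = 2 * a := ⟨r / 2, by omega⟩
      exact h.rows a (by omega)
  · rintro ⟨hC, hR⟩
    refine ⟨⟨p, hp⟩, fun a ha => ?_, fun b hb => ?_⟩
    · rcases Nat.eq_zero_or_pos a with rfl | ha0
      · exact T.rowsLinked_zero (by omega)
      · exact hR _ (by omega) (by omega) (by omega)
    · rw [← rowsLinked_transpose]
      rcases Nat.eq_zero_or_pos b with rfl | hb0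
      · refine T.transpose.rowsLinked_zero ?_
        change 1 < T.cols
        omega
      · refine hC _ (by omega) (by omega) ?_
        rw [rows_transpose]
        omega

/-- If `u i + v j` is the indicator of a dot, then the sum of `u` tells whether this dot belongs
to the link of two rows. -/
theorem Paired.sum_range_rows {T : CNAT} (hT : T.Paired) {u v : ℕ → ZMod 2} {x y : ℕ}
    (hd : (x, y) ∈ T.dots)
    (huv : ∀ i j, (i, j) ∈ T.dots → u i + v j = if (i, j) = (x, y) then 1 else 0) :
    ∑ i ∈ Finset.range T.rows, u i = if (mate x, y) ∈ T.dots then 1 else 0 := by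
  obtain ⟨p, hp⟩ := hT.even_rows
  have hx := (T.mem_grid _ hd).1
  have hpair : ∀ a ∈ Finset.range p, u (2 * a) + u (2 * a + 1) =
      if x / 2 = a then if (mate x, y) ∈ T.dots then 1 else 0 else 0 := by
    intro a ha
    rw [Finset.mem_range] at ha
    obtain ⟨c, h1, h2⟩ := hT.rows a (by omega)
    have hsum : u (2 * a) + u (2 * a + 1) = (if (2 * a, c) = (x, y) then 1 else 0) +
        if (2 * a + 1, c) = (x, y) then 1 else 0 := by
      rw [← huv _ _ h1, ← huv _ _ h2, add_add_add_comm, CharTwo.add_self_eq_zero (v c), add_zero]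
    rw [hsum]
    by_cases hxa : x / 2 = a
    · rw [if_pos hxa]
      obtain rfl | rfl : x = 2 * a ∨ x = 2 * a + 1 := by omega
      · rw [mate_two_mul]
        by_cases hm : (2 * a + 1, y) ∈ T.dots
        · simp [T.rowsLinked_col_unique h1 h2 hd hm, h2]
        · have : c ≠ y := by
            rintro rfl
            exact hm h2
          simp [hm, this]
      · rw [mate_two_mul_add_one]
        by_cases hm : (2 * a, y) ∈ T.dots
        · simp [T.rowsLinked_col_unique h1 h2 hm hd, h1]
        · have : c ≠ y := by
            rintro rfl
            exact hm h1
          simp [hm, this]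
    · rw [if_neg hxa, if_neg, if_neg, add_zero]
      · rw [Prod.mk.injEq]
        omega
      · rw [Prod.mk.injEq]
        omega
  rw [hp, ← two_mul, sum_range_two_mul, Finset.sum_congr rfl hpair, Finset.sum_ite_eq,
    if_pos (Finset.mem_range.2 (by simp only at hx; omega))]

/-- A dot is a leaf if and only if it belongs to exactly one of the links: both sides are the
value modulo `2` of the sum of `u` and `v`, where `u i + v j` is the indicator of the dot. -/
theorem Paired.mem_leaves_iff {T : CNAT} (hT : T.Paired) {x y : ℕ} (hd : (x, y) ∈ T.dots) :
    (x, y) ∈ T.leaves ↔ ¬((mate x, y) ∈ T.dots ↔ (x, mate y) ∈ T.dots) := by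
  obtain ⟨u, v, huv⟩ := T.exists_potential fun d => (if d = (x, y) then 1 else 0 : ZMod 2)
  have hsum := sum_leaves_potential (w := fun d => if d = (x, y) then 1 else 0) huv
  have hcols : ∑ j ∈ Finset.range T.cols, v j = if (x, mate y) ∈ T.dots then 1 else 0 := by
    have := hT.transpose.sum_range_rows (u := v) (v := u) (mem_transpose.2 hd) fun i j hij => by
      rw [add_comm, huv j i (mem_transpose.1 hij)]
      simp [and_comm]
    simpa only [mem_transpose, rows_transpose] using this
  rw [hT.sum_range_rows hd huv, hcols, Finset.sum_ite_eq'] at hsum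
  revert hsum
  by_cases h1 : (x, y) ∈ T.leaves <;> by_cases h2 : (mate x, y) ∈ T.dots <;>
    by_cases h3 : (x, mate y) ∈ T.dots <;> simp only [h1, h2, h3, if_true, if_false] <;> decide

theorem mem_leaves_transpose {T : CNAT} {i j : ℕ} :
    (i, j) ∈ T.transpose.leaves ↔ (j, i) ∈ T.leaves := by
  simp only [mem_leaves, NonAmbiguousTree.IsLeaf, NonAmbiguousTree.HasBelow,
    NonAmbiguousTree.HasRight, mem_transpose, and_comm]

/-- A link of two rows is always accompanied by a link of two columns with the same upper left
dot. -/
theorem Paired.block_of_rows {T : CNAT} (hT : T.Paired) {a y : ℕ} (h : (2 * a, y) ∈ T.dots)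
    (h' : (2 * a + 1, y) ∈ T.dots) :
    ∃ b, y = 2 * b ∧ (2 * a, 2 * b + 1) ∈ T.dots ∧ (2 * a + 1, 2 * b) ∈ T.leaves := by
  have hnl : (2 * a, y) ∉ T.leaves := fun hl =>
    (mem_leaves.1 hl).2.1 ⟨2 * a + 1, (2 * a).lt_succ_self, h'⟩
  rw [hT.mem_leaves_iff h, mate_two_mul, not_not] at hnl
  have hm := hnl.1 h'
  rcases Nat.even_or_odd' y with ⟨b, rfl | rfl⟩
  · rw [mate_two_mul] at hm
    refine ⟨b, rfl, hm, ?_⟩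
    rw [hT.mem_leaves_iff h', mate_two_mul_add_one, mate_two_mul]
    exact fun hiff => T.not_above_and_left (hiff.1 h) (2 * a).lt_succ_self hm
      (2 * b).lt_succ_self h'
  · -- the dot `(2 * a, 2 * b)` is linked to its right neighbour and is not a leaf, which forces a
    -- forbidden square of four dots
    rw [mate_two_mul_add_one] at hm
    have hnl' : (2 * a, 2 * b) ∉ T.leaves := fun hl =>
      (mem_leaves.1 hl).2.2 ⟨2 * b + 1, (2 * b).lt_succ_self, h⟩
    rw [hT.mem_leaves_iff hm, mate_two_mul, mate_two_mul, not_not] at hnl'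
    exact (T.not_above_and_left h' (2 * a).lt_succ_self h (2 * b).lt_succ_self
      (hnl'.2 h)).elim

theorem Paired.block_of_cols {T : CNAT} (hT : T.Paired) {x b : ℕ} (h : (x, 2 * b) ∈ T.dots)
    (h' : (x, 2 * b + 1) ∈ T.dots) :
    ∃ a, x = 2 * a ∧ (2 * a + 1, 2 * b) ∈ T.dots ∧ (2 * a, 2 * b + 1) ∈ T.leaves := by
  simpa only [mem_transpose, mem_leaves_transpose] using
    hT.transpose.block_of_rows (mem_transpose.2 h) (mem_transpose.2 h')

/-- A row of odd index has a single dot, which is the lower left cell of a block with exactly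
three dots, two of which are leaves. -/
theorem Paired.block_of_odd_row {T : CNAT} (hT : T.Paired) {a y : ℕ}
    (h : (2 * a + 1, y) ∈ T.dots) :
    ∃ b, y = 2 * b ∧ (2 * a, 2 * b) ∈ T.dots ∧ (2 * a + 1, 2 * b) ∈ T.leaves ∧
      (2 * a, 2 * b + 1) ∈ T.leaves := by
  have hlt := (T.mem_grid _ h).1
  simp only at hlt
  obtain ⟨c, h1, h2⟩ := hT.rows a (by omega)
  obtain ⟨b, rfl, hr, hl⟩ := hT.block_of_rows h1 h2
  obtain ⟨a', ha', -, hl'⟩ := hT.block_of_cols h1 hr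
  obtain rfl : a = a' := by omega
  refine ⟨b, ?_, h1, hl, hl'⟩
  rcases lt_trichotomy y (2 * b) with hlt | heq | hlt
  · exact (T.not_above_and_left h2 (2 * a).lt_succ_self h1 hlt h).elim
  · exact heq
  · exact ((mem_leaves.1 hl).2.2 ⟨y, hlt, h⟩).elim

theorem Paired.block_of_odd_col {T : CNAT} (hT : T.Paired) {x b : ℕ}
    (h : (x, 2 * b + 1) ∈ T.dots) :
    ∃ a, x = 2 * a ∧ (2 * a, 2 * b) ∈ T.dots ∧ (2 * a, 2 * b + 1) ∈ T.leaves ∧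
      (2 * a + 1, 2 * b) ∈ T.leaves := by
  simpa only [mem_transpose, mem_leaves_transpose] using
    hT.transpose.block_of_odd_row (mem_transpose.2 h)

theorem Paired.even_even_notMem_leaves {T : CNAT} (hT : T.Paired) {a b : ℕ} :
    (2 * a, 2 * b) ∉ T.leaves := by
  intro hl
  have hd := T.leaves_subset_dots hl
  have hiff := (hT.mem_leaves_iff hd).1 hl
  rw [mate_two_mul, mate_two_mul] at hiff
  obtain ⟨-, hb, hr⟩ := mem_leaves.1 hl
  exact hiff (iff_of_false (fun h => hb ⟨_, (2 * a).lt_succ_self, h⟩)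
    fun h => hr ⟨_, (2 * b).lt_succ_self, h⟩)

/-- A dot in even position with a dot below it either has another dot in even position below it,
or is the upper left cell of a block with two leaves. -/
theorem Paired.exists_below {T : CNAT} (hT : T.Paired) {a b : ℕ}
    (h : T.HasBelow (2 * a, 2 * b)) :
    (2 * a + 1, 2 * b) ∈ T.leaves ∨ ∃ a', a < a' ∧ (2 * a', 2 * b) ∈ T.dots := by
  obtain ⟨i, hi, hd⟩ := h
  simp only at hi hd
  rcases Nat.even_or_odd' i with ⟨a', rfl | rfl⟩
  · exact Or.inr ⟨a', by omega, hd⟩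
  · obtain ⟨b', hb', h1, h2, -⟩ := hT.block_of_odd_row hd
    obtain rfl : b = b' := by omega
    rcases eq_or_ne a a' with rfl | hne
    · exact Or.inl h2
    · exact Or.inr ⟨a', by omega, h1⟩

theorem Paired.exists_right {T : CNAT} (hT : T.Paired) {a b : ℕ}
    (h : T.HasRight (2 * a, 2 * b)) :
    (2 * a, 2 * b + 1) ∈ T.leaves ∨ ∃ b', b < b' ∧ (2 * a, 2 * b') ∈ T.dots := by
  obtain ⟨j, hj, hd⟩ := h
  simpa only [mem_transpose, mem_leaves_transpose] using
    hT.transpose.exists_below (a := b) (b := a) ⟨j, hj, mem_transpose.2 hd⟩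

/-- The two leaves of a block come together. -/
theorem Paired.leaf_right_iff {T : CNAT} (hT : T.Paired) {a b : ℕ} :
    (2 * a, 2 * b + 1) ∈ T.leaves ↔ (2 * a + 1, 2 * b) ∈ T.leaves := by
  constructor
  · intro h
    obtain ⟨a', ha', -, -, h'⟩ := hT.block_of_odd_col (T.leaves_subset_dots h)
    obtain rfl : a = a' := by omega
    exact h'
  · intro h
    obtain ⟨b', hb', -, -, h'⟩ := hT.block_of_odd_row (T.leaves_subset_dots h)
    obtain rfl : b = b' := by omega
    exact h'

/-! ### Halving -/

theorem injective_two_mul : Function.Injective fun d : ℕ × ℕ => (2 * d.1, 2 * d.2) := by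
  rintro ⟨a, b⟩ ⟨a', b'⟩ h
  simp only [Prod.mk.injEq] at h ⊢
  omega

/-- The tree of half the size formed by the upper left cells of the `2 × 2` blocks. -/
noncomputable def half (T : CNAT) (hT : T.Paired) : CNAT where
  rows := T.rows / 2
  cols := T.cols / 2
  dots := T.dots.preimage (fun d => (2 * d.1, 2 * d.2)) injective_two_mul.injOn
  mem_grid d hd := by
    have h := T.mem_grid _ (Finset.mem_preimage.1 hd)
    obtain ⟨p, hp⟩ := hT.even_rows
    have hrc := T.rows_eq_cols
    simp only at h
    omega
  root_mem := Finset.mem_preimage.2 T.root_mem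
  nonambiguous := by
    rintro ⟨a, b⟩ hd hne
    simp only [Finset.mem_preimage] at hd ⊢
    have habove : (∃ i, i < a ∧ (2 * i, 2 * b) ∈ T.dots) ↔
        ∃ i, i < 2 * a ∧ (i, 2 * b) ∈ T.dots := by
      refine ⟨fun ⟨i, hi, h⟩ => ⟨2 * i, by omega, h⟩, fun ⟨i, hi, h⟩ => ?_⟩
      rcases Nat.even_or_odd' i with ⟨a', rfl | rfl⟩
      · exact ⟨a', by omega, h⟩
      · obtain ⟨b', hb', -, hl, -⟩ := hT.block_of_odd_row h
        exact ((mem_leaves.1 hl).2.1 ⟨2 * a, hi, hb' ▸ hd⟩).elim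
    have hleft : (∃ j, j < b ∧ (2 * a, 2 * j) ∈ T.dots) ↔
        ∃ j, j < 2 * b ∧ (2 * a, j) ∈ T.dots := by
      refine ⟨fun ⟨j, hj, h⟩ => ⟨2 * j, by omega, h⟩, fun ⟨j, hj, h⟩ => ?_⟩
      rcases Nat.even_or_odd' j with ⟨b', rfl | rfl⟩
      · exact ⟨b', by omega, h⟩
      · obtain ⟨a', ha', -, hl, -⟩ := hT.block_of_odd_col h
        exact ((mem_leaves.1 hl).2.2 ⟨2 * b, hj, ha' ▸ hd⟩).elim
    rw [habove, hleft]
    refine T.nonambiguous _ hd fun h => hne ?_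
    simp only [Prod.mk.injEq] at h ⊢
    omega
  row_nonempty a ha := by
    obtain ⟨y, hy⟩ := T.row_nonempty (2 * a + 1) (by omega)
    obtain ⟨b, -, h, -⟩ := hT.block_of_odd_row hy
    exact ⟨b, Finset.mem_preimage.2 h⟩
  col_nonempty b hb := by
    obtain ⟨x, hx⟩ := T.col_nonempty (2 * b + 1) (by omega)
    obtain ⟨a, -, h, -⟩ := hT.block_of_odd_col hx
    exact ⟨a, Finset.mem_preimage.2 h⟩
  complete := by
    rintro ⟨a, b⟩ hd
    simp only [NonAmbiguousTree.HasBelow, NonAmbiguousTree.HasRight, Finset.mem_preimage] at hd ⊢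
    rcases T.complete _ hd with ⟨hb, hr⟩ | ⟨hb, hr⟩
    · rcases hT.exists_below hb with hl | hb'
      · have hl' := hT.leaf_right_iff.2 hl
        refine Or.inr ⟨?_, ?_⟩
        · rintro ⟨i, hi, h⟩
          refine (mem_leaves.1 hl).2.1 ⟨2 * i, ?_, h⟩
          simp only
          omega
        · rintro ⟨j, hj, h⟩
          refine (mem_leaves.1 hl').2.2 ⟨2 * j, ?_, h⟩
          simp only
          omega
      · rcases hT.exists_right hr with hl | hr'
        · obtain ⟨i, hi, h⟩ := hb'
          refine ((mem_leaves.1 (hT.leaf_right_iff.1 hl)).2.1 ⟨2 * i, ?_, h⟩).elim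
          simp only
          omega
        · exact Or.inl ⟨hb', hr'⟩
    · exact (hT.even_even_notMem_leaves (mem_leaves.2 ⟨hd, hb, hr⟩)).elim

theorem mem_half {T : CNAT} {hT : T.Paired} {a b : ℕ} :
    (a, b) ∈ (T.half hT).dots ↔ (2 * a, 2 * b) ∈ T.dots := by
  simp [half]

theorem mem_leaves_half {T : CNAT} {hT : T.Paired} {a b : ℕ} :
    (a, b) ∈ (T.half hT).leaves ↔ (2 * a + 1, 2 * b) ∈ T.leaves := by
  rw [mem_leaves, NonAmbiguousTree.IsLeaf, mem_half]
  constructor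
  · rintro ⟨hd, hb, hr⟩
    rcases T.complete _ hd with ⟨hb', -⟩ | h
    · rcases hT.exists_below hb' with hl | ⟨i, hi, h⟩
      · exact hl
      · exact (hb ⟨i, hi, mem_half.2 h⟩).elim
    · exact (hT.even_even_notMem_leaves (mem_leaves.2 ⟨hd, h⟩)).elim
  · intro hl
    have hl' := hT.leaf_right_iff.2 hl
    obtain ⟨b', hb', hd, -⟩ := hT.block_of_odd_row (T.leaves_subset_dots hl)
    refine ⟨hb' ▸ hd, ?_, ?_⟩
    · rintro ⟨i, hi, h⟩
      refine (mem_leaves.1 hl).2.1 ⟨2 * i, ?_, mem_half.1 h⟩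
      simp only at hi ⊢
      omega
    · rintro ⟨j, hj, h⟩
      refine (mem_leaves.1 hl').2.2 ⟨2 * j, ?_, mem_half.1 h⟩
      simp only at hj ⊢
      omega

/-! ### Doubling -/

/-- The dots obtained by replacing each leaf by a `2 × 2` block with three dots and each other
dot by a block whose only dot is its upper left cell. -/
noncomputable def doubleDots (T : CNAT) : Finset (ℕ × ℕ) :=
  T.dots.image (fun d => (2 * d.1, 2 * d.2)) ∪ T.leaves.image (fun d => (2 * d.1, 2 * d.2 + 1)) ∪
    T.leaves.image (fun d => (2 * d.1 + 1, 2 * d.2))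

section double

variable {T : CNAT} {a b : ℕ}

theorem even_even_mem_doubleDots : (2 * a, 2 * b) ∈ T.doubleDots ↔ (a, b) ∈ T.dots := by
  simp only [doubleDots, Finset.mem_union, Finset.mem_image, Prod.mk.injEq, Prod.exists]
  constructor
  · rintro ((⟨i, j, h, h1, h2⟩ | ⟨i, j, h, h1, h2⟩) | ⟨i, j, h, h1, h2⟩)
    · obtain ⟨rfl, rfl⟩ : i = a ∧ j = b := by omega
      exact h
    · omega
    · omega
  · exact fun h => Or.inl (Or.inl ⟨a, b, h, rfl, rfl⟩)

theorem even_odd_mem_doubleDots : (2 * a, 2 * b + 1) ∈ T.doubleDots ↔ (a, b) ∈ T.leaves := by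
  simp only [doubleDots, Finset.mem_union, Finset.mem_image, Prod.mk.injEq, Prod.exists]
  constructor
  · rintro ((⟨i, j, h, h1, h2⟩ | ⟨i, j, h, h1, h2⟩) | ⟨i, j, h, h1, h2⟩)
    · omega
    · obtain ⟨rfl, rfl⟩ : i = a ∧ j = b := by omega
      exact h
    · omega
  · exact fun h => Or.inl (Or.inr ⟨a, b, h, rfl, rfl⟩)

theorem odd_even_mem_doubleDots : (2 * a + 1, 2 * b) ∈ T.doubleDots ↔ (a, b) ∈ T.leaves := by
  simp only [doubleDots, Finset.mem_union, Finset.mem_image, Prod.mk.injEq, Prod.exists]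
  constructor
  · rintro ((⟨i, j, h, h1, h2⟩ | ⟨i, j, h, h1, h2⟩) | ⟨i, j, h, h1, h2⟩)
    · omega
    · omega
    · obtain ⟨rfl, rfl⟩ : i = a ∧ j = b := by omega
      exact h
  · exact fun h => Or.inr ⟨a, b, h, rfl, rfl⟩

theorem odd_odd_notMem_doubleDots : (2 * a + 1, 2 * b + 1) ∉ T.doubleDots := by
  simp only [doubleDots, Finset.mem_union, Finset.mem_image, Prod.mk.injEq, Prod.exists]
  rintro ((⟨i, j, h, h1, h2⟩ | ⟨i, j, h, h1, h2⟩) | ⟨i, j, h, h1, h2⟩) <;> omega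

theorem le_of_mem_leaves_of_mem_col {i i' j : ℕ} (hl : (i, j) ∈ T.leaves)
    (hd : (i', j) ∈ T.dots) : i' ≤ i :=
  not_lt.1 fun h => (mem_leaves.1 hl).2.1 ⟨i', h, hd⟩

theorem le_of_mem_leaves_of_mem_row {i j j' : ℕ} (hl : (i, j) ∈ T.leaves)
    (hd : (i, j') ∈ T.dots) : j' ≤ j :=
  not_lt.1 fun h => (mem_leaves.1 hl).2.2 ⟨j', h, hd⟩

theorem mem_even_col_doubleDots {i : ℕ} (h : (i, 2 * b) ∈ T.doubleDots) :
    (i = 2 * (i / 2) ∧ (i / 2, b) ∈ T.dots) ∨ (i = 2 * (i / 2) + 1 ∧ (i / 2, b) ∈ T.leaves) := by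
  rcases Nat.even_or_odd' i with ⟨a, rfl | rfl⟩
  · rw [even_even_mem_doubleDots] at h
    rw [Nat.mul_div_cancel_left _ Nat.two_pos]
    exact Or.inl ⟨rfl, h⟩
  · rw [odd_even_mem_doubleDots] at h
    rw [show (2 * a + 1) / 2 = a by omega]
    exact Or.inr ⟨rfl, h⟩

theorem mem_even_row_doubleDots {j : ℕ} (h : (2 * a, j) ∈ T.doubleDots) :
    (j = 2 * (j / 2) ∧ (a, j / 2) ∈ T.dots) ∨ (j = 2 * (j / 2) + 1 ∧ (a, j / 2) ∈ T.leaves) := by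
  rcases Nat.even_or_odd' j with ⟨b, rfl | rfl⟩
  · rw [even_even_mem_doubleDots] at h
    rw [Nat.mul_div_cancel_left _ Nat.two_pos]
    exact Or.inl ⟨rfl, h⟩
  · rw [even_odd_mem_doubleDots] at h
    rw [show (2 * b + 1) / 2 = b by omega]
    exact Or.inr ⟨rfl, h⟩

theorem mem_odd_col_doubleDots {i : ℕ} (h : (i, 2 * b + 1) ∈ T.doubleDots) :
    i = 2 * (i / 2) ∧ (i / 2, b) ∈ T.leaves := by
  rcases Nat.even_or_odd' i with ⟨a, rfl | rfl⟩
  · rw [even_odd_mem_doubleDots] at h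
    rw [Nat.mul_div_cancel_left _ Nat.two_pos]
    exact ⟨rfl, h⟩
  · exact (odd_odd_notMem_doubleDots h).elim

theorem mem_odd_row_doubleDots {j : ℕ} (h : (2 * a + 1, j) ∈ T.doubleDots) :
    j = 2 * (j / 2) ∧ (a, j / 2) ∈ T.leaves := by
  rcases Nat.even_or_odd' j with ⟨b, rfl | rfl⟩
  · rw [odd_even_mem_doubleDots] at h
    rw [Nat.mul_div_cancel_left _ Nat.two_pos]
    exact ⟨rfl, h⟩
  · exact (odd_odd_notMem_doubleDots h).elim

/-- The tree with dots `T.doubleDots`. -/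
noncomputable def double (T : CNAT) : CNAT where
  rows := 2 * T.rows
  cols := 2 * T.cols
  dots := T.doubleDots
  mem_grid := by
    rintro ⟨i, j⟩ hd
    rcases Nat.even_or_odd' i with ⟨a, rfl | rfl⟩
    · rcases mem_even_row_doubleDots hd with ⟨hj, h⟩ | ⟨hj, h⟩
      · have := T.mem_grid _ h
        simp only at this ⊢
        omega
      · have := T.mem_grid _ (T.leaves_subset_dots h)
        simp only at this ⊢
        omega
    · obtain ⟨hj, h⟩ := mem_odd_row_doubleDots hd
      have := T.mem_grid _ (T.leaves_subset_dots h)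
      simp only at this ⊢
      omega
  root_mem := even_even_mem_doubleDots.2 T.root_mem
  nonambiguous := by
    rintro ⟨i, j⟩ hd hne
    rcases Nat.even_or_odd' i with ⟨a, rfl | rfl⟩ <;>
      rcases Nat.even_or_odd' j with ⟨b, rfl | rfl⟩ <;> simp only
    · rw [even_even_mem_doubleDots] at hd
      have habove : (∃ i, i < 2 * a ∧ (i, 2 * b) ∈ T.doubleDots) ↔
          ∃ i, i < a ∧ (i, b) ∈ T.dots := by
        refine ⟨fun ⟨i, hi, h⟩ => ?_, fun ⟨i, hi, h⟩ =>
          ⟨2 * i, by omega, even_even_mem_doubleDots.2 h⟩⟩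
        rcases mem_even_col_doubleDots h with ⟨_, h⟩ | ⟨_, h⟩
        · exact ⟨i / 2, by omega, h⟩
        · exact ⟨i / 2, by omega, T.leaves_subset_dots h⟩
      have hleft : (∃ j, j < 2 * b ∧ (2 * a, j) ∈ T.doubleDots) ↔
          ∃ j, j < b ∧ (a, j) ∈ T.dots := by
        refine ⟨fun ⟨j, hj, h⟩ => ?_, fun ⟨j, hj, h⟩ =>
          ⟨2 * j, by omega, even_even_mem_doubleDots.2 h⟩⟩
        rcases mem_even_row_doubleDots h with ⟨_, h⟩ | ⟨_, h⟩
        · exact ⟨j / 2, by omega, h⟩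
        · exact ⟨j / 2, by omega, T.leaves_subset_dots h⟩
      rw [habove, hleft]
      refine T.nonambiguous _ hd fun h => hne ?_
      simp only [Prod.mk.injEq] at h ⊢
      omega
    · rw [even_odd_mem_doubleDots] at hd
      refine Or.inr ⟨⟨2 * b, by omega, even_even_mem_doubleDots.2 (T.leaves_subset_dots hd)⟩, ?_⟩
      rintro ⟨i, hi, h⟩
      obtain ⟨_, h⟩ := mem_odd_col_doubleDots h
      have := le_of_mem_leaves_of_mem_col h (T.leaves_subset_dots hd)
      omega
    · rw [odd_even_mem_doubleDots] at hd
      refine Or.inl ⟨⟨2 * a, by omega, even_even_mem_doubleDots.2 (T.leaves_subset_dots hd)⟩, ?_⟩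
      rintro ⟨j, hj, h⟩
      obtain ⟨_, h⟩ := mem_odd_row_doubleDots h
      have := le_of_mem_leaves_of_mem_row h (T.leaves_subset_dots hd)
      omega
    · exact (odd_odd_notMem_doubleDots hd).elim
  row_nonempty i hi := by
    obtain ⟨j, hj, -⟩ := T.existsUnique_leaf_row (i := i / 2) (by omega)
    rcases Nat.even_or_odd' i with ⟨a, rfl | rfl⟩
    · rw [Nat.mul_div_cancel_left _ Nat.two_pos] at hj
      exact ⟨2 * j + 1, even_odd_mem_doubleDots.2 hj⟩
    · rw [show (2 * a + 1) / 2 = a by omega] at hj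
      exact ⟨2 * j, odd_even_mem_doubleDots.2 hj⟩
  col_nonempty j hj := by
    obtain ⟨i, hi, -⟩ := T.existsUnique_leaf_col (j := j / 2) (by omega)
    rcases Nat.even_or_odd' j with ⟨b, rfl | rfl⟩
    · rw [Nat.mul_div_cancel_left _ Nat.two_pos] at hi
      exact ⟨2 * i + 1, odd_even_mem_doubleDots.2 hi⟩
    · rw [show (2 * b + 1) / 2 = b by omega] at hi
      exact ⟨2 * i, even_odd_mem_doubleDots.2 hi⟩
  complete := by
    rintro ⟨i, j⟩ hd
    rcases Nat.even_or_odd' i with ⟨a, rfl | rfl⟩ <;>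
      rcases Nat.even_or_odd' j with ⟨b, rfl | rfl⟩ <;>
      simp only [NonAmbiguousTree.HasBelow, NonAmbiguousTree.HasRight]
    · rw [even_even_mem_doubleDots] at hd
      rcases T.complete _ hd with ⟨⟨i, hi, hid⟩, ⟨j, hj, hjd⟩⟩ | h
      · simp only at hi hj
        exact Or.inl ⟨⟨2 * i, by omega, even_even_mem_doubleDots.2 hid⟩,
          ⟨2 * j, by omega, even_even_mem_doubleDots.2 hjd⟩⟩
      · have hl : (a, b) ∈ T.leaves := mem_leaves.2 ⟨hd, h⟩
        exact Or.inl ⟨⟨2 * a + 1, by omega, odd_even_mem_doubleDots.2 hl⟩,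
          ⟨2 * b + 1, by omega, even_odd_mem_doubleDots.2 hl⟩⟩
    · rw [even_odd_mem_doubleDots] at hd
      refine Or.inr ⟨?_, ?_⟩
      · rintro ⟨i, hi, h⟩
        obtain ⟨_, h⟩ := mem_odd_col_doubleDots h
        have := le_of_mem_leaves_of_mem_col hd (T.leaves_subset_dots h)
        omega
      · rintro ⟨j, hj, h⟩
        have : j / 2 ≤ b := by
          rcases mem_even_row_doubleDots h with ⟨_, h⟩ | ⟨_, h⟩
          · exact le_of_mem_leaves_of_mem_row hd h
          · exact le_of_mem_leaves_of_mem_row hd (T.leaves_subset_dots h)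
        omega
    · rw [odd_even_mem_doubleDots] at hd
      refine Or.inr ⟨?_, ?_⟩
      · rintro ⟨i, hi, h⟩
        have : i / 2 ≤ a := by
          rcases mem_even_col_doubleDots h with ⟨_, h⟩ | ⟨_, h⟩
          · exact le_of_mem_leaves_of_mem_col hd h
          · exact le_of_mem_leaves_of_mem_col hd (T.leaves_subset_dots h)
        omega
      · rintro ⟨j, hj, h⟩
        obtain ⟨_, h⟩ := mem_odd_row_doubleDots h
        have := le_of_mem_leaves_of_mem_row hd (T.leaves_subset_dots h)
        omega
    · exact (odd_odd_notMem_doubleDots hd).elim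

end double

theorem size_double (T : CNAT) : T.double.size = 2 * T.size := by
  rw [← rows_eq_size, ← rows_eq_size]
  rfl

theorem paired_double (T : CNAT) : T.double.Paired where
  even_rows := even_two_mul _
  rows a ha := by
    obtain ⟨j, hj, -⟩ := T.existsUnique_leaf_row (i := a) (by
      change 2 * a < 2 * T.rows at ha
      omega)
    exact ⟨2 * j, even_even_mem_doubleDots.2 (T.leaves_subset_dots hj),
      odd_even_mem_doubleDots.2 hj⟩
  cols b hb := by
    obtain ⟨i, hi, -⟩ := T.existsUnique_leaf_col (j := b) (by
      change 2 * b < 2 * T.cols at hb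
      omega)
    exact ⟨2 * i, even_even_mem_doubleDots.2 (T.leaves_subset_dots hi),
      even_odd_mem_doubleDots.2 hi⟩

theorem half_double (T : CNAT) : T.double.half T.paired_double = T := by
  refine CNAT.ext (Nat.mul_div_cancel_left _ Nat.two_pos)
    (Nat.mul_div_cancel_left _ Nat.two_pos) ?_
  ext ⟨a, b⟩
  rw [mem_half]
  exact even_even_mem_doubleDots

theorem double_half {T : CNAT} (hT : T.Paired) : (T.half hT).double = T := by
  have hc := T.rows_eq_cols ▸ hT.even_rows
  refine CNAT.ext (Nat.two_mul_div_two_of_even hT.even_rows) (Nat.two_mul_div_two_of_even hc) ?_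
  ext ⟨i, j⟩
  change (i, j) ∈ (T.half hT).doubleDots ↔ _
  rcases Nat.even_or_odd' i with ⟨a, rfl | rfl⟩ <;>
    rcases Nat.even_or_odd' j with ⟨b, rfl | rfl⟩
  · rw [even_even_mem_doubleDots, mem_half]
  · rw [even_odd_mem_doubleDots, mem_leaves_half, ← hT.leaf_right_iff]
    refine ⟨fun h => T.leaves_subset_dots h, fun h => ?_⟩
    obtain ⟨a', ha', -, h', -⟩ := hT.block_of_odd_col h
    rwa [← ha'] at h'
  · rw [odd_even_mem_doubleDots, mem_leaves_half]
    refine ⟨fun h => T.leaves_subset_dots h, fun h => ?_⟩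
    obtain ⟨b', hb', -, h', -⟩ := hT.block_of_odd_row h
    rwa [← hb'] at h'
  · refine iff_of_false odd_odd_notMem_doubleDots fun h => ?_
    obtain ⟨b', hb', -⟩ := hT.block_of_odd_row h
    omega

/-- In suitable bases the matrix of the doubled tree is made of the four blocks `M`, `L`, `L`, `0`
where `M` is the matrix of the tree and `L` its restriction to the leaves, of determinant `± 1`. -/
theorem det_double (T : CNAT) : T.double.matrix.det = (-1) ^ T.size := by
  set M := dotMatrix T.size T.dots with hM
  set L := dotMatrix T.size T.leaves with hL
  let e : Fin T.size ⊕ Fin T.size ≃ Fin (2 * T.size) :=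
    (Equiv.boolProdEquivSum (Fin T.size)).symm.trans <| (Equiv.prodComm _ _).trans <|
      (Equiv.prodCongr (Equiv.refl _) finTwoEquiv.symm).trans <| finProdFinEquiv.trans <|
      finCongr (Nat.mul_comm _ _)
  have he1 : ∀ a, (e (Sum.inl a) : ℕ) = 2 * a := fun a => by
    simp [e, finTwoEquiv, Equiv.boolProdEquivSum]
  have he2 : ∀ a, (e (Sum.inr a) : ℕ) = 2 * a + 1 := fun a => by
    simp [e, finTwoEquiv, Equiv.boolProdEquivSum, add_comm]
  have hsub : (dotMatrix (2 * T.size) T.double.dots).submatrix e e =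
      Matrix.fromBlocks M L L 0 := by
    ext i j
    simp only [Matrix.submatrix_apply, dotMatrix, Matrix.of_apply]
    rcases i with a | a <;> rcases j with b | b <;> simp only [he1, he2, hM, hL, dotMatrix,
      Matrix.fromBlocks_apply₁₁, Matrix.fromBlocks_apply₁₂, Matrix.fromBlocks_apply₂₁,
      Matrix.fromBlocks_apply₂₂, Matrix.of_apply, Matrix.zero_apply]
    · exact if_congr even_even_mem_doubleDots rfl rfl
    · exact if_congr even_odd_mem_doubleDots rfl rfl
    · exact if_congr odd_even_mem_doubleDots rfl rfl
    · exact if_neg odd_odd_notMem_doubleDots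
  have hfac : Matrix.fromBlocks M L L 0 = Matrix.fromBlocks L M 0 L *
      (Matrix.fromBlocks 1 1 1 0 * Matrix.fromBlocks 1 0 (-1) 1) := by
    simp [Matrix.fromBlocks_multiply]
  have hdet : L.det * L.det = 1 := by
    rw [hL, T.det_dotMatrix_eq_sign subset_rfl T.leaves_subset_dots, ← Units.val_mul,
      Int.units_mul_self, Units.val_one]
  rw [det_matrix_eq T.size_double, ← Matrix.det_submatrix_equiv_self e, hsub, hfac, Matrix.det_mul,
    Matrix.det_mul, Matrix.det_fromBlocks_zero₂₁, hdet, Matrix.det_fromBlocks_one₁₁,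
    Matrix.det_fromBlocks_zero₁₂]
  simp [Matrix.det_neg]

/-! ### Counting -/

theorem card_finsetOfSize (n : ℕ) : (finsetOfSize n).card = count n :=
  (Set.ncard_eq_toFinset_card _ _).symm

theorem detSum_of_odd {n : ℕ} (h1 : 1 < n) (hn : Odd n) : detSum n (fun _ => True) = 0 := by
  rw [detSum_true_eq n 1]
  refine detSum_eq_zero fun T hT h => ?_
  subst hT
  exact not_allLinked_of_odd h1 hn h.1 h.2

theorem detSum_two_mul (p : ℕ) : detSum (2 * p) (fun _ => True) = (-1) ^ p * count p := by
  classical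
  have hP : detSum (2 * p) (fun _ => True) = detSum (2 * p) Paired := by
    rw [detSum_true_eq _ 0]
    exact detSum_congr fun T hT => (paired_iff (hT ▸ even_two_mul p)).symm
  have hsum : ∑ _T ∈ finsetOfSize p, ((-1) ^ p : ℤ) = detSum (2 * p) Paired := by
    refine Finset.sum_bij' (fun T _ => T.double)
      (fun T hT => T.half (Finset.mem_filter.1 hT).2) ?_ ?_ (fun T _ => T.half_double)
      (fun T hT => double_half (Finset.mem_filter.1 hT).2) ?_
    · intro T hT
      rw [mem_finsetOfSize] at hT
      rw [Finset.mem_filter, mem_finsetOfSize, size_double, hT]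
      exact ⟨rfl, T.paired_double⟩
    · intro T hT
      rw [Finset.mem_filter, mem_finsetOfSize] at hT
      rw [mem_finsetOfSize, ← rows_eq_size]
      change T.rows / 2 = p
      rw [rows_eq_size, hT.1, Nat.mul_div_cancel_left _ Nat.two_pos]
    · intro T hT
      rw [mem_finsetOfSize] at hT
      rw [det_double, hT]
  rw [hP, ← hsum, Finset.sum_const, card_finsetOfSize, nsmul_eq_mul, mul_comm]

theorem det_matrix_eq_or (T : CNAT) : T.matrix.det = 1 ∨ T.matrix.det = -1 := by
  rw [det_matrix]
  rcases Int.units_eq_one_or (Equiv.Perm.sign T.leafPerm) with h | h <;> simp [h]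

theorem detCount_eq_card (n : ℕ) (ε : ℤ) :
    detCount n ε = ((finsetOfSize n).filter fun T => T.matrix.det = ε).card := by
  rw [detCount, ← Set.ncard_coe_finset]
  congr 1
  ext T
  simp [mem_finsetOfSize, ofSize]

theorem detCount_add (n : ℕ) : detCount n 1 + detCount n (-1) = count n := by
  rw [detCount_eq_card, detCount_eq_card, ← card_finsetOfSize,
    ← Finset.card_filter_add_card_filter_not (s := finsetOfSize n) fun T => T.matrix.det = 1]
  congr 2
  refine Finset.filter_congr fun T _ => ?_
  have := T.det_matrix_eq_or
  omega

theorem detCount_sub (n : ℕ) :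
    (detCount n 1 : ℤ) - detCount n (-1) = detSum n fun _ => True := by
  classical
  rw [detCount_eq_card, detCount_eq_card, Finset.card_filter, Finset.card_filter, Nat.cast_sum,
    Nat.cast_sum, ← Finset.sum_sub_distrib, detSum, Finset.filter_true]
  refine Finset.sum_congr rfl fun T _ => ?_
  rcases T.det_matrix_eq_or with h | h <;> simp [h]

theorem signCount_eq_detCount (n : ℕ) (ε : ℤ) : signCount n ε = detCount n ε := by
  simp only [signCount, detCount, det_matrix]

theorem detCount_eq_of_detSum {n : ℕ} {s : ℤ} (hs : detSum n (fun _ => True) = s) :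
    (detCount n 1 : ℚ) = ((count n : ℚ) + s) / 2 ∧
      (detCount n (-1) : ℚ) = ((count n : ℚ) - s) / 2 := by
  have h1 : (detCount n 1 : ℚ) + detCount n (-1) = count n := by exact_mod_cast detCount_add n
  have h2 : (detCount n 1 : ℚ) - detCount n (-1) = s := by exact_mod_cast (detCount_sub n).trans hs
  constructor <;> linarith

end CNAT

theorem theorem1 :
    (∀ n : ℕ, 1 < n → Odd n →
      ((CNAT.detCount n 1 : ℚ) = (CNAT.count n : ℚ) / 2 ∧
        (CNAT.detCount n (-1) : ℚ) = (CNAT.count n : ℚ) / 2) ∧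
      ((CNAT.signCount n 1 : ℚ) = (CNAT.count n : ℚ) / 2 ∧
        (CNAT.signCount n (-1) : ℚ) = (CNAT.count n : ℚ) / 2)) ∧
    (∀ p : ℕ,
      ((CNAT.detCount (2 * p) 1 : ℚ) =
          ((CNAT.count (2 * p) : ℚ) + (-1) ^ p * (CNAT.count p : ℚ)) / 2 ∧
        (CNAT.detCount (2 * p) (-1) : ℚ) =
          ((CNAT.count (2 * p) : ℚ) - (-1) ^ p * (CNAT.count p : ℚ)) / 2) ∧
      ((CNAT.signCount (2 * p) 1 : ℚ) =
          ((CNAT.count (2 * p) : ℚ) + (-1) ^ p * (CNAT.count p : ℚ)) / 2 ∧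
        (CNAT.signCount (2 * p) (-1) : ℚ) =
          ((CNAT.count (2 * p) : ℚ) - (-1) ^ p * (CNAT.count p : ℚ)) / 2)) := by
  simp only [CNAT.signCount_eq_detCount, and_self]
  constructor
  · intro n h1 hn
    simpa using CNAT.detCount_eq_of_detSum (CNAT.detSum_of_odd h1 hn)
  · intro p
    simpa using CNAT.detCount_eq_of_detSum (CNAT.detSum_two_mul p)
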